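/- Let $G$ be a plane graph, that is, a simple graph (finite or infinite) together with an embedding in $\mathbb{R}^2$: the vertices are distinct points, every edge is a simple curve (an injective continuous image of $[0,1]$) joining the points of its two end vertices and containing no other vertex, and two different edges meet only in common end points. Let $X$ be a cycle in $G$ (with at least three vertices), and let $C\subset\mathbb{R}^2$ be the union of the curves representing the edges of $X$. Say that two vertices not on $C$ are on the same side of $X$ if they lie in the same connected component of $\mathbb{R}^2\setminus C$. If a vertex $x$ of $G$ is adjacent to every vertex of $X$, then there is no vertex $y\neq x$ of $G$ such that $y$ is on the same side of $X$ as $x$ and $y$ is adjacent to every vertex of $X$. -/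

import Mathlib

/-- The Euclidean plane. -/
abbrev Plane : Type := EuclideanSpace ℝ (Fin 2)

/-- An embedding of a simple graph in the plane: distinct vertices are distinct points, every
edge is a simple curve joining its end vertices, a curve passes through no vertex except the
ends of its edge, and two different curves meet only at common end points. A plane graph is a
graph together with such an embedding. -/
structure PlaneEmbedding {V : Type*} (G : SimpleGraph V) where
  /-- the point that represents a vertex -/
  point : V → Plane
  /-- the curve, as a set of points, that represents an edge -/
  curve : G.edgeSet → Set Plane
  point_injective : Function.Injective point
  curve_isArc : ∀ (u v : V) (h : G.Adj u v), ∃ γ : Path (point u) (point v),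
    Function.Injective γ ∧ Set.range γ = curve ⟨s(u, v), h⟩
  mem_of_point_mem_curve : ∀ (e : G.edgeSet) (w : V), point w ∈ curve e → w ∈ (e : Sym2 V)
  curve_inter : ∀ e f : G.edgeSet, e ≠ f → ∀ p ∈ curve e ∩ curve f,
    ∃ w : V, w ∈ (e : Sym2 V) ∧ w ∈ (f : Sym2 V) ∧ p = point w

namespace PlaneEmbedding

variable {V : Type*} {G : SimpleGraph V}

/-- The union of the curves that represent the edges of a walk; a closed curve if the walk is a
cycle. -/
def walkCurve (E : PlaneEmbedding G) {u v : V} (X : G.Walk u v) : Set Plane :=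
  ⋃ e ∈ {e : G.edgeSet | (e : Sym2 V) ∈ X.edges}, E.curve e

/-- `x` and `y` are on the same side of `X`: they are off the curve of `X` and in the same
connected component of its complement (`connectedComponentIn F p` is empty if `p ∉ F`, and
contained in `F` always). -/
def SameSide (E : PlaneEmbedding G) {u v : V} (X : G.Walk u v) (x y : V) : Prop :=
  E.point y ∈ connectedComponentIn (E.walkCurve X)ᶜ (E.point x)

end PlaneEmbedding

open Set unitInterval

/-!
Let `x` and `y` be joined to the vertices `v i` by edges `α i` and `β i`, and let `τ i` be the
part of the cycle from `v (i + 1)` to `v (i - 1)` that misses `v i`. The only tool is the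
increment `Δ γ p` of a continuous logarithm of `z - p` as `z` runs along a path `γ`. For disjoint
paths `γ : a ⟶ b` and `δ : c ⟶ d` the function `γ t - δ s` has a logarithm on the whole square,
which gives `Δ γ c + Δ δ b = Δ γ d + Δ δ a`. Applied to `τ i` and `α i`, `β i`, and to `α i` and
`β j` with `i ≠ j`, this identity expresses the difference of the winding numbers of the cycle
about `x` and `y` as a sum of three terms, each of which is twice a logarithm of `-1`. Hence that
difference is odd, whereas it would be zero if `x` and `y` were on the same side.
-/

section ContinuousLogarithm

instance contractibleSpace_unitInterval : ContractibleSpace I :=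
  (convex_Icc 0 1).contractibleSpace ⟨0, by simp⟩

theorem exists_continuousMap_exp_eq {A : Type*} [TopologicalSpace A] [ContractibleSpace A]
    (f : C(A, ℂ)) (hf : ∀ a, f a ≠ 0) : ∃ L : C(A, ℂ), ∀ a, Complex.exp (L a) = f a := by
  let g : C(A, {z : ℂ // z ≠ 0}) := ⟨fun a ↦ ⟨f a, hf a⟩, by fun_prop⟩
  obtain ⟨a₀, ⟨H⟩⟩ := id_nullhomotopic A
  let H' : C(I × A, {z : ℂ // z ≠ 0}) := g.comp (H.symm : C(I × A, A))
  have exp_log_eq (a : A) : H' (0, a) = (fun z : ℂ ↦ (⟨_, z.exp_ne_zero⟩ : {z : ℂ // z ≠ 0}))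
      (ContinuousMap.const A (Complex.log (f a₀)) a) :=
    Subtype.ext (by simp [H', g, Complex.exp_log (hf a₀)])
  let Λ := Complex.isCoveringMap_exp.liftHomotopy H' _ exp_log_eq
  have exp_Λ (a : A) : Complex.exp (Λ (1, a)) = H' (1, a) := congrArg Subtype.val
    (congrFun (Complex.isCoveringMap_exp.liftHomotopy_lifts H' _ exp_log_eq) (1, a))
  exact ⟨Λ.comp ((ContinuousMap.const A 1).prodMk (ContinuousMap.id A)), fun a ↦
    (exp_Λ a).trans (by simp [H', g])⟩

theorem eq_of_exp_eq_of_isPreconnected {A : Type*} [TopologicalSpace A] {K : Set A} {f : A → ℂ}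
    (hK : IsPreconnected K) (hf : ContinuousOn f K)
    (hexp : ∀ p ∈ K, ∀ q ∈ K, Complex.exp (f p) = Complex.exp (f q))
    {p q : A} (hp : p ∈ K) (hq : q ∈ K) : f p = f q :=
  Complex.isCoveringMap_exp.constOn_of_comp hK hf
    (fun p hp q hq ↦ Subtype.ext (hexp p hp q hq)) hp hq

end ContinuousLogarithm

section LogIncrement

open Classical in
/-- The increment along `γ` of a continuous logarithm of `z - p`. For a closed path it is `2πi`
times the winding number about `p`. The value is `0` if `p` lies on `γ`. -/
noncomputable def logIncrement {a b : ℂ} (γ : Path a b) (p : ℂ) : ℂ :=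
  if h : ∃ L : C(I, ℂ), ∀ t, Complex.exp (L t) = γ t - p then h.choose 1 - h.choose 0 else 0

variable {a b c d p : ℂ} {γ : Path a b} {δ : Path c d}

theorem logIncrement_eq_sub {L : I → ℂ} (hL : Continuous L)
    (hexp : ∀ t, Complex.exp (L t) = γ t - p) : logIncrement γ p = L 1 - L 0 := by
  have hex : ∃ L : C(I, ℂ), ∀ t, Complex.exp (L t) = γ t - p := ⟨⟨L, hL⟩, hexp⟩
  have hone (t : I) : Complex.exp (hex.choose t - L t) = 1 := by
    rw [Complex.exp_sub, hex.choose_spec, ← hexp, div_self (Complex.exp_ne_zero _)]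
  have hconst : hex.choose 1 - L 1 = hex.choose 0 - L 0 :=
    eq_of_exp_eq_of_isPreconnected isPreconnected_univ
      (hex.choose.continuous.sub hL).continuousOn
      (fun s _ t _ ↦ (hone s).trans (hone t).symm) (mem_univ 1) (mem_univ 0)
  rw [logIncrement, dif_pos hex]
  linear_combination hconst

theorem exp_logIncrement (hp : p ∉ range γ) :
    Complex.exp (logIncrement γ p) = (b - p) / (a - p) := by
  obtain ⟨L, hL⟩ := exists_continuousMap_exp_eq (A := I) ⟨fun t ↦ γ t - p, by fun_prop⟩
    fun t ↦ sub_ne_zero.2 fun h ↦ hp ⟨t, h⟩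
  rw [logIncrement_eq_sub L.continuous hL, Complex.exp_sub, hL, hL]
  simp

theorem continuousOn_logIncrement (γ : Path a b) : ContinuousOn (logIncrement γ) (range γ)ᶜ := by
  intro p hp
  obtain ⟨r, hr, hball⟩ :=
    Metric.isOpen_iff.1 (isCompact_range γ.continuous).isClosed.isOpen_compl p hp
  have : ContractibleSpace (Metric.ball p r) := Metric.contractibleSpace_ball hr
  obtain ⟨L, hL⟩ := exists_continuousMap_exp_eq (A := I × Metric.ball p r)
    ⟨fun q ↦ γ q.1 - q.2, by fun_prop⟩ fun q ↦ sub_ne_zero.2 fun h ↦ hball q.2.2 ⟨q.1, h⟩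
  have heq : (Metric.ball p r).domRestrict (logIncrement γ) = fun q ↦ L (1, q) - L (0, q) :=
    funext fun q ↦ logIncrement_eq_sub (L := fun t ↦ L (t, q)) (by fun_prop) fun t ↦ hL (t, q)
  have hcont : ContinuousOn (logIncrement γ) (Metric.ball p r) := by
    rw [continuousOn_iff_continuous_domRestrict, heq]
    fun_prop
  exact (hcont.continuousAt (Metric.ball_mem_nhds p hr)).continuousWithinAt

theorem logIncrement_add_logIncrement_of_disjoint (h : Disjoint (range γ) (range δ)) :
    logIncrement γ c + logIncrement δ b = logIncrement γ d + logIncrement δ a := by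
  obtain ⟨L, hL⟩ := exists_continuousMap_exp_eq (A := I × I) ⟨fun q ↦ γ q.1 - δ q.2, by fun_prop⟩
    fun q ↦ sub_ne_zero.2 (h.ne_of_mem (mem_range_self q.1) (mem_range_self q.2))
  have hγ (s : I) : logIncrement γ (δ s) = L (1, s) - L (0, s) :=
    logIncrement_eq_sub (L := fun t ↦ L (t, s)) (by fun_prop) fun t ↦ hL (t, s)
  have hδ (t : I) : logIncrement δ (γ t) = L (t, 1) - L (t, 0) := by
    have hexp (s : I) : Complex.exp (L (t, s) + Real.pi * Complex.I) = δ s - γ t := by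
      rw [Complex.exp_add, Complex.exp_pi_mul_I, hL]
      simp
    rw [logIncrement_eq_sub (L := fun s ↦ L (t, s) + Real.pi * Complex.I) (by fun_prop) hexp]
    ring
  have hc := hγ 0
  have hd := hγ 1
  have ha := hδ 0
  have hb := hδ 1
  simp only [Path.source, Path.target] at ha hb hc hd
  rw [ha, hb, hc, hd]
  ring

theorem sum_logIncrement_eq_of_isPreconnected {ι : Type*} [Fintype ι] {v : ι → ℂ}
    {e e' : Equiv.Perm ι} (τ : ∀ i, Path (v (e i)) (v (e' i))) {K : Set ℂ}
    (hK : IsPreconnected K) (hτ : ∀ i, Disjoint K (range (τ i))) {p q : ℂ} (hp : p ∈ K)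
    (hq : q ∈ K) : ∑ i, logIncrement (τ i) p = ∑ i, logIncrement (τ i) q := by
  have hexp : ∀ r ∈ K, Complex.exp (∑ i, logIncrement (τ i) r) = 1 := fun r hr ↦ by
    have hne (i : ι) : v i - r ≠ 0 := sub_ne_zero.2 fun h ↦
      (hτ (e.symm i)).ne_of_mem hr ⟨0, by simp⟩ h.symm
    simp only [Complex.exp_sum, exp_logIncrement (disjoint_left.1 (hτ _) hr),
      Finset.prod_div_distrib]
    rw [Equiv.prod_comp e' fun i ↦ v i - r, Equiv.prod_comp e fun i ↦ v i - r]
    exact div_self (Finset.prod_ne_zero_iff.2 fun i _ ↦ hne i)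
  refine eq_of_exp_eq_of_isPreconnected hK (continuousOn_finsetSum _ fun i _ ↦ ?_)
    (fun r hr s hs ↦ (hexp r hr).trans (hexp s hs).symm) hp hq
  exact (continuousOn_logIncrement (τ i)).mono (hτ i).subset_compl_right

end LogIncrement

section Arcs

variable {x y u w : ℂ}

theorem exists_exp_eq_neg_one_of_disjoint {α : Path x u} {β : Path u y} {α' : Path x w}
    {β' : Path w y} (h : Disjoint (range α) (range β')) (h' : Disjoint (range α') (range β)) :
    ∃ m : ℂ, Complex.exp m = -1 ∧
      (logIncrement α w + logIncrement β w) - (logIncrement α' u + logIncrement β' u) =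
        2 * m + (logIncrement α' y + logIncrement β' x) -
          (logIncrement α y + logIncrement β x) := by
  refine ⟨logIncrement α w + logIncrement β w - logIncrement α' y - logIncrement β' x, ?_, ?_⟩
  · have hw : w ∉ range α := disjoint_right.1 h ⟨0, β'.source⟩
    have hw' : w ∉ range β := disjoint_left.1 h' ⟨1, α'.target⟩
    have hy : y ∉ range α' := disjoint_right.1 h' ⟨1, β.target⟩
    have hx : x ∉ range β' := disjoint_left.1 h ⟨0, α.source⟩
    have hxw : x - w ≠ 0 := sub_ne_zero.2 fun e ↦ hw ⟨0, by simp [e]⟩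
    have huw : u - w ≠ 0 := sub_ne_zero.2 fun e ↦ hw ⟨1, by simp [e]⟩
    have hxy : x - y ≠ 0 := sub_ne_zero.2 fun e ↦ hy ⟨0, by simp [e]⟩
    have hwy : w - y ≠ 0 := sub_ne_zero.2 fun e ↦ hy ⟨1, by simp [e]⟩
    rw [Complex.exp_sub, Complex.exp_sub, Complex.exp_add, exp_logIncrement hw,
      exp_logIncrement hw', exp_logIncrement hy, exp_logIncrement hx, ← neg_sub w y, ← neg_sub x w,
      ← neg_sub x y]
    field_simp
  · linear_combination -logIncrement_add_logIncrement_of_disjoint h -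
      logIncrement_add_logIncrement_of_disjoint h'

theorem logIncrement_sub_logIncrement_of_disjoint {v : ℂ} {α : Path x v} {β : Path v y}
    {τ : Path u w} (hα : Disjoint (range τ) (range α)) (hβ : Disjoint (range τ) (range β)) :
    logIncrement τ x - logIncrement τ y =
      (logIncrement α u + logIncrement β u) - (logIncrement α w + logIncrement β w) := by
  linear_combination logIncrement_add_logIncrement_of_disjoint hα +
    logIncrement_add_logIncrement_of_disjoint hβ

theorem not_isPreconnected_of_disjoint_arcs {ι : Type*} [Fintype ι] (hι : Odd (Fintype.card ι))
    {e : Equiv.Perm ι} {v : ι → ℂ} {α : ∀ i, Path x (v i)}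
    {β : ∀ i, Path (v i) y} {τ : ∀ i, Path (v (e i)) (v (e.symm i))}
    (hαβ : Pairwise fun i j ↦ Disjoint (range (α i)) (range (β j)))
    (hτα : ∀ i, Disjoint (range (τ i)) (range (α i)))
    (hτβ : ∀ i, Disjoint (range (τ i)) (range (β i)))
    {K : Set ℂ} (hτK : ∀ i, Disjoint K (range (τ i))) (hx : x ∈ K) (hy : y ∈ K) :
    ¬ IsPreconnected K := by
  intro hK
  have he (i : ι) : e i ≠ i := fun h ↦
    (hτα i).ne_of_mem ⟨0, (τ i).source⟩ ⟨1, (α i).target⟩ (congrArg v h)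
  let arc (i : ι) (p : ℂ) : ℂ := logIncrement (α i) p + logIncrement (β i) p
  choose m hm harc using fun i ↦
    exists_exp_eq_neg_one_of_disjoint (hαβ (he i).symm) (hαβ (he i))
  have hsum : 2 * ∑ i, m i = 0 := calc
    2 * ∑ i, m i = ∑ i, (arc i (v (e i)) - arc (e i) (v i)) := by
      simp only [arc, harc, Finset.sum_sub_distrib, Finset.sum_add_distrib, Finset.mul_sum,
        Equiv.sum_comp e fun i ↦ logIncrement (α i) y,
        Equiv.sum_comp e fun i ↦ logIncrement (β i) x]
      ring
    _ = ∑ i, (arc i (v (e i)) - arc i (v (e.symm i))) := by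
      rw [Finset.sum_sub_distrib, Finset.sum_sub_distrib,
        ← Equiv.sum_comp e fun i ↦ arc i (v (e.symm i))]
      simp only [Equiv.symm_apply_apply]
    _ = ∑ i, logIncrement (τ i) x - ∑ i, logIncrement (τ i) y := by
      rw [← Finset.sum_sub_distrib]
      exact Finset.sum_congr rfl fun i _ ↦
        (logIncrement_sub_logIncrement_of_disjoint (hτα i) (hτβ i)).symm
    _ = 0 := sub_eq_zero.2 (sum_logIncrement_eq_of_isPreconnected τ hK hτK hx hy)
  have hexp : Complex.exp (∑ i, m i) = -1 := by
    simp only [Complex.exp_sum, hm, Finset.prod_const, Finset.card_univ, hι.neg_one_pow]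
  rw [(mul_eq_zero.1 hsum).resolve_left two_ne_zero, Complex.exp_zero] at hexp
  norm_num at hexp

end Arcs

section Cycle

variable {V : Type*} {G : SimpleGraph V} {a : V} {X : G.Walk a a}

theorem two_lt_encard_support_of_isCycle (hX : X.IsCycle) :
    2 < {v | v ∈ X.support}.encard := by
  classical
  have hcard : X.support.tail.toFinset.card = X.length := by
    rw [List.toFinset_card_of_nodup hX.support_nodup, List.length_tail,
      SimpleGraph.Walk.length_support, Nat.add_sub_cancel]
  calc (2 : ℕ∞) < X.length := by exact_mod_cast hX.three_le_length
    _ = (X.support.tail.toFinset : Set V).encard := by rw [encard_coe_eq_coe_finsetCard, hcard]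
    _ ≤ {v | v ∈ X.support}.encard :=
      encard_le_encard fun v hv ↦ List.mem_of_mem_tail (List.mem_toFinset.1 hv)

theorem exists_walk_notMem_support_of_isCycle (hX : X.IsCycle) {u v w : V} (hu : u ∈ X.support)
    (hv : v ∈ X.support) (hw : w ∈ X.support) (huv : u ≠ v) (hwv : w ≠ v) :
    ∃ W : G.Walk u w, v ∉ W.support ∧ W.edges ⊆ X.edges := by
  classical
  let P := (X.rotate v hv).tail
  have hP : P.IsPath := (hX.rotate hv).isPath_tail
  have mem_P {z : V} (hz : z ∈ X.support) (hzv : z ≠ v) : z ∈ P.support := by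
    rw [← X.mem_support_rotate_iff v hv,
      ← SimpleGraph.Walk.cons_support_tail (hX.rotate hv).not_nil] at hz
    exact (List.mem_cons.1 hz).resolve_left hzv
  have edges_P : P.edges ⊆ X.edges := fun e h ↦
    (X.rotate_edges v hv).mem_iff.1 (List.mem_of_mem_tail (SimpleGraph.Walk.edges_tail ▸ h))
  refine ⟨(P.takeUntil u (mem_P hu huv)).reverse.append (P.takeUntil w (mem_P hw hwv)), ?_, ?_⟩
  · simpa using ⟨SimpleGraph.Walk.endpoint_notMem_support_takeUntil hP _ huv.symm,
      SimpleGraph.Walk.endpoint_notMem_support_takeUntil hP _ hwv.symm⟩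
  · intro e h
    rw [SimpleGraph.Walk.edges_append, SimpleGraph.Walk.edges_reverse, List.mem_append,
      List.mem_reverse] at h
    exact edges_P (h.elim (P.edges_takeUntil_subset_edges _ ·) (P.edges_takeUntil_subset_edges _ ·))

end Cycle

namespace PlaneEmbedding

variable {V : Type*} {G : SimpleGraph V} (E : PlaneEmbedding G)

theorem mem_walkCurve {u v : V} {X : G.Walk u v} {p : Plane} :
    p ∈ E.walkCurve X ↔ ∃ e : G.edgeSet, (e : Sym2 V) ∈ X.edges ∧ p ∈ E.curve e := by
  simp [walkCurve]

theorem walkCurve_mono {u v u' v' : V} {X : G.Walk u v} {Y : G.Walk u' v'}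
    (h : X.edges ⊆ Y.edges) : E.walkCurve X ⊆ E.walkCurve Y :=
  biUnion_subset_biUnion_left fun _ he ↦ h he

theorem point_mem_curve {e : G.edgeSet} {w : V} (hw : w ∈ (e : Sym2 V)) :
    E.point w ∈ E.curve e := by
  obtain ⟨e, he⟩ := e
  obtain ⟨z, rfl⟩ := Sym2.mem_iff_exists.1 hw
  obtain ⟨γ, -, hγ⟩ := E.curve_isArc w z he
  exact hγ ▸ ⟨0, γ.source⟩

theorem point_mem_walkCurve {u v w : V} {X : G.Walk u v} (hX : ¬ X.Nil) (hw : w ∈ X.support) :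
    E.point w ∈ E.walkCurve X := by
  obtain ⟨e, he, hwe⟩ := (SimpleGraph.Walk.mem_support_iff_exists_mem_edges_of_not_nil hX).1 hw
  exact E.mem_walkCurve.2 ⟨⟨e, X.edges_subset_edgeSet he⟩, he, E.point_mem_curve hwe⟩

theorem disjoint_curve {e f : G.edgeSet} (h : ∀ w ∈ (e : Sym2 V), w ∉ (f : Sym2 V)) :
    Disjoint (E.curve e) (E.curve f) := by
  have hne : e ≠ f := by
    rintro rfl
    exact h _ (Sym2.out_fst_mem _) (Sym2.out_fst_mem _)
  refine disjoint_left.2 fun p he hf ↦ ?_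
  obtain ⟨w, hwe, hwf, -⟩ := E.curve_inter e f hne p ⟨he, hf⟩
  exact h w hwe hwf

theorem disjoint_walkCurve_curve {u v : V} {X : G.Walk u v} {e : G.edgeSet}
    (h : ∀ w ∈ (e : Sym2 V), w ∉ X.support) : Disjoint (E.walkCurve X) (E.curve e) :=
  disjoint_iUnion₂_left.2 fun _ hf ↦ E.disjoint_curve fun w hwf hwe ↦
    h w hwe (X.mem_support_of_mem_edges hf hwf)

theorem exists_path_range_subset_walkCurve {u v : V} {X : G.Walk u v} (hX : ¬ X.Nil) :
    ∃ γ : Path (E.point u) (E.point v), range γ ⊆ E.walkCurve X := by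
  induction X with
  | nil => exact absurd .nil hX
  | @cons u w v h p ih =>
    obtain ⟨γ, -, hγ⟩ := E.curve_isArc u w h
    have hγp : range γ ⊆ E.walkCurve (p.cons h) := fun z hz ↦
      E.mem_walkCurve.2 ⟨⟨s(u, w), h⟩, by simp, hγ ▸ hz⟩
    cases p with
    | nil => exact ⟨γ, hγp⟩
    | cons h' q =>
      obtain ⟨δ, hδ⟩ := ih SimpleGraph.Walk.not_nil_cons
      refine ⟨γ.trans δ, ?_⟩
      rw [Path.trans_range]
      exact union_subset hγp (hδ.trans (E.walkCurve_mono (by simp)))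

theorem not_isPreconnected_of_walks {ι : Type*} [Fintype ι] (hι : Odd (Fintype.card ι))
    {e : Equiv.Perm ι} {x y : V} (hxy : x ≠ y) {v : ι → V}
    (hv : Function.Injective v) (hx : ∀ i, G.Adj x (v i)) (hy : ∀ i, G.Adj y (v i))
    {W : ∀ i, G.Walk (v (e i)) (v (e.symm i))} (hWnil : ∀ i, ¬ (W i).Nil)
    (hvW : ∀ i, v i ∉ (W i).support) {K : Set Plane}
    (hKW : ∀ i, Disjoint K (E.walkCurve (W i))) (hxK : E.point x ∈ K) (hyK : E.point y ∈ K) :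
    ¬ IsPreconnected K := by
  choose α _ hα using fun i ↦ E.curve_isArc x (v i) (hx i)
  choose β _ hβ using fun i ↦ E.curve_isArc (v i) y (hy i).symm
  choose τ hτ using fun i ↦ E.exists_path_range_subset_walkCurve (hWnil i)
  have hαβ : Pairwise fun i j ↦ Disjoint (range (α i)) (range (β j)) := fun i j hij ↦ by
    simp only [hα, hβ]
    exact E.disjoint_curve (by simp [hxy, (hx j).ne, (hy i).ne', hv.ne hij])
  have notMem_support {z : V} (hzK : E.point z ∈ K) (i : ι) : z ∉ (W i).support := fun hz ↦
    disjoint_left.1 (hKW i) hzK (E.point_mem_walkCurve (hWnil i) hz)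
  have hτα (i : ι) : Disjoint (range (τ i)) (range (α i)) := by
    rw [hα]
    exact (E.disjoint_walkCurve_curve (by simp [notMem_support hxK, hvW])).mono_left (hτ i)
  have hτβ (i : ι) : Disjoint (range (τ i)) (range (β i)) := by
    rw [hβ]
    exact (E.disjoint_walkCurve_curve (by simp [notMem_support hyK, hvW])).mono_left (hτ i)
  let Φ : Plane ≃ₜ ℂ := Complex.orthonormalBasisOneI.repr.symm.toHomeomorph
  have range_map {p q : Plane} (γ : Path p q) : range (γ.map Φ.continuous) = Φ '' range γ := by
    rw [Path.map_coe, range_comp]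
  intro hK
  refine not_isPreconnected_of_disjoint_arcs hι (K := Φ '' K)
    (α := fun i ↦ (α i).map Φ.continuous) (β := fun i ↦ (β i).map Φ.continuous)
    (τ := fun i ↦ (τ i).map Φ.continuous) ?_ ?_ ?_ ?_ (mem_image_of_mem Φ hxK)
    (mem_image_of_mem Φ hyK) (hK.image Φ Φ.continuous.continuousOn) <;>
  simp only [range_map, disjoint_image_iff Φ.injective]
  exacts [hαβ, hτα, hτβ, fun i ↦ (hKW i).mono_right (hτ i)]

theorem not_sameSide_of_three_common_neighbors {a : V} {X : G.Walk a a} (hX : X.IsCycle)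
    {x y : V} (hxy : x ≠ y) {v : Fin 3 → V} (hv : Function.Injective v)
    (hvX : ∀ i, v i ∈ X.support) (hx : ∀ i, G.Adj x (v i)) (hy : ∀ i, G.Adj y (v i)) :
    ¬ E.SameSide X x y := by
  intro hside
  let e : Equiv.Perm (Fin 3) := finRotate 3
  have he : ∀ i, e i ≠ i := by decide
  have he' : ∀ i, e.symm i ≠ i := by decide
  have hee' : ∀ i, e i ≠ e.symm i := by decide
  choose W hvW hWX using fun i ↦ exists_walk_notMem_support_of_isCycle hX (hvX (e i)) (hvX i)
    (hvX (e.symm i)) (hv.ne (he i)) (hv.ne (he' i))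
  have hxX : E.point x ∈ (E.walkCurve X)ᶜ := connectedComponentIn_nonempty_iff.1 ⟨_, hside⟩
  refine E.not_isPreconnected_of_walks (by decide) hxy hv hx hy
    (fun i ↦ SimpleGraph.Walk.not_nil_of_ne (hv.ne (hee' i))) hvW (fun i ↦ ?_)
    (mem_connectedComponentIn hxX) hside isPreconnected_connectedComponentIn
  exact (disjoint_compl_left.mono_left (connectedComponentIn_subset _ _)).mono_right
    (E.walkCurve_mono (hWX i))

end PlaneEmbedding

theorem theorem1_general {V : Type*} {G : SimpleGraph V} (E : PlaneEmbedding G) {a : V}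
    {X : G.Walk a a} (hX : X.IsCycle) {x y : V} (hxy : x ≠ y) (hside : E.SameSide X x y) :
    (G.commonNeighbors x y ∩ {v | v ∈ X.support}).encard ≤ 2 := by
  by_contra! h
  obtain ⟨s, hs, hcard⟩ := exists_subset_encard_eq (k := 3) (Order.add_one_le_of_lt h)
  obtain ⟨u, v, w, huv, huw, hvw, rfl⟩ := encard_eq_three.1 hcard
  have hinj : Function.Injective ![u, v, w] := by
    intro i j
    fin_cases i <;> fin_cases j <;> simp [huv, huv.symm, huw, huw.symm, hvw, hvw.symm]
  have hmem (i : Fin 3) : ![u, v, w] i ∈ G.commonNeighbors x y ∩ {v | v ∈ X.support} :=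
    hs (by fin_cases i <;> simp)
  exact E.not_sameSide_of_three_common_neighbors hX hxy hinj (fun i ↦ (hmem i).2)
    (fun i ↦ (hmem i).1.1) (fun i ↦ (hmem i).1.2) hside

theorem theorem1 {V : Type*} {G : SimpleGraph V} (E : PlaneEmbedding G)
    {a : V} (X : G.Walk a a) (hX : X.IsCycle)
    (x : V) (hx : ∀ v ∈ X.support, G.Adj x v) :
    ¬ ∃ y : V, y ≠ x ∧ E.SameSide X x y ∧ ∀ v ∈ X.support, G.Adj y v := by
  rintro ⟨y, hyx, hside, hy⟩
  have hsub : {v | v ∈ X.support} ⊆ G.commonNeighbors x y ∩ {v | v ∈ X.support} :=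
    fun v hv ↦ ⟨⟨hx v hv, hy v hv⟩, hv⟩
  exact (two_lt_encard_support_of_isCycle hX).not_ge
    ((encard_le_encard hsub).trans (theorem1_general E hX hyx.symm hside))
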